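/- Let $(S,d)$ be a non-empty, separable and complete metric space, and let $\mathcal{P}^1(S)$ be the set of all Borel probability measures $P$ on $S$ with a finite first moment, i.e. with $\int_S d(a,\cdot)\,dP<\infty$ for some (equivalently, every) $a\in S$. For $P,Q\in\mathcal{P}^1(S)$ let $$W(P,Q)=\inf_{\pi}\int_{S\times S} d(x,y)\,d\pi(x,y),$$ the infimum taken over all Borel probability measures $\pi$ on $S\times S$ with first marginal $P$ and second marginal $Q$, be the Wasserstein metric. For $\Gamma\subset\mathcal{P}^1(S)$ define, as elements of $[0,\infty]$ (with $\sup\emptyset=0$ and $\inf\emptyset=\infty$), the measure of non-uniform integrability $$\mu_{\mathrm{UI}}(\Gamma)=\inf_{a\in S}\ \inf_{B}\ \sup_{P\in\Gamma}\int_{S\setminus B}d(a,\cdot)\,dP,$$ where $B$ runs over the bounded Borel subsets of $S$, and the relative Hausdorff measure of non-compactness for $W$ $$\mu_{\mathrm{H},W}(\Gamma)=\inf_{\Phi}\ \sup_{P\in\Gamma}\ \inf_{Q\in\Phi}W(P,Q),$$ where $\Phi$ runs over the finite subsets of $\mathcal{P}^1(S)$. Then, for every $\Gamma\subset\mathcal{P}^1(S)$,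 $$\mu_{\mathrm{UI}}(\Gamma)\le\mu_{\mathrm{H},W}(\Gamma).$$ Moreover, equality holds if $\Gamma$ is tight, i.e. if for each $\varepsilon>0$ there is a compact set $K\subset S$ such that $P(S\setminus K)<\varepsilon$ for every $P\in\Gamma$. -/

import Mathlib

open MeasureTheory
open scoped ENNReal

section WassersteinNoncompactness

variable {S : Type*} [MetricSpace S] [MeasurableSpace S]

/-- The set `𝒫¹(S)` of the probability measures on `S` with a finite first moment. -/
def finiteFirstMoment (S : Type*) [MetricSpace S] [MeasurableSpace S] :
    Set (ProbabilityMeasure S) :=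
  {P | ∃ a : S, ∫⁻ x, edist a x ∂(P : Measure S) < ∞}

/-- `π` is a coupling of `P` and `Q`: its first marginal is `P` and its second marginal is `Q`. -/
def IsCouplingOf (π : ProbabilityMeasure (S × S)) (P Q : ProbabilityMeasure S) : Prop :=
  (π : Measure (S × S)).map Prod.fst = (P : Measure S) ∧
    (π : Measure (S × S)).map Prod.snd = (Q : Measure S)

/-- The Wasserstein distance `W(P, Q) = inf_π ∫ d(x, y) dπ(x, y)`, the infimum taken over all
couplings `π` of `P` and `Q`. It takes values in `[0, ∞]`, and is finite on `𝒫¹(S)`. -/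
noncomputable def wassersteinW (P Q : ProbabilityMeasure S) : ℝ≥0∞ :=
  ⨅ (π : ProbabilityMeasure (S × S)) (_ : IsCouplingOf π P Q),
    ∫⁻ z, edist z.1 z.2 ∂(π : Measure (S × S))

/-- The relative Hausdorff measure of non-compactness for the Wasserstein metric on `𝒫¹(S)`:
`inf_Φ sup_{P ∈ Γ} inf_{Q ∈ Φ} W(P, Q)`, where `Φ` runs over the finite subsets of `𝒫¹(S)`. -/
noncomputable def muHW (Γ : Set (ProbabilityMeasure S)) : ℝ≥0∞ :=
  ⨅ (Φ : Set (ProbabilityMeasure S)) (_ : Φ ⊆ finiteFirstMoment S) (_ : Φ.Finite),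
    ⨆ P ∈ Γ, ⨅ Q ∈ Φ, wassersteinW P Q

/-- The measure of non-uniform integrability:
`inf_a inf_B sup_{P ∈ Γ} ∫_{S ∖ B} d(a, x) dP(x)`, where `a` runs over the points of `S` and
`B` over the bounded measurable subsets of `S`. -/
noncomputable def muUI (Γ : Set (ProbabilityMeasure S)) : ℝ≥0∞ :=
  ⨅ (a : S) (B : Set S) (_ : Bornology.IsBounded B) (_ : MeasurableSet B),
    ⨆ P ∈ Γ, ∫⁻ x in Bᶜ, edist a x ∂(P : Measure S)

end WassersteinNoncompactness

open Filter Topology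

section WassersteinNoncompactness

variable {S : Type*} [MetricSpace S] [MeasurableSpace S]

/-! For `muUI ≤ muHW`, couple P with a nearby Q: by d(a,x) ≤ d(x,y) + d(a,y), the tail of P costs at
most the transport cost plus the tail of Q plus a bounded multiple of the P-mass far from a, and
Markov makes that mass small uniformly in P. Finitely many Q share one radius. Conversely, if Γ is
tight, one simple function f nearly fixes the points of B ∩ K, with K compact, and sends all others
to a, so transport along f costs little more than the tail off B. The images of P live on the finite
range of f; rounding their weights to multiples of 1/N, with the excess sent to a, leaves finitely
many targets. -/

/-- The first moment of a measure in `𝒫¹(S)` is finite about every point. -/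
theorem lintegral_edist_lt_top {Q : ProbabilityMeasure S} (hQ : Q ∈ finiteFirstMoment S) (a : S) :
    ∫⁻ x, edist a x ∂(Q : Measure S) < ∞ := by
  obtain ⟨b, hb⟩ := hQ
  calc ∫⁻ x, edist a x ∂(Q : Measure S)
      ≤ ∫⁻ x, (edist a b + edist b x) ∂(Q : Measure S) :=
        lintegral_mono fun x => edist_triangle a b x
    _ = edist a b + ∫⁻ x, edist b x ∂(Q : Measure S) := by
        rw [lintegral_add_left measurable_const]; simp
    _ < ∞ := ENNReal.add_lt_top.2 ⟨edist_lt_top a b, hb⟩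

/-! ### Non-uniform integrability bounded by non-compactness -/

theorem tendsto_setLIntegral_edist_nat [BorelSpace S]
    {Q : ProbabilityMeasure S} (hQ : Q ∈ finiteFirstMoment S) (a : S) :
    Tendsto (fun n : ℕ => ∫⁻ y in {y | (n : ℝ≥0∞) ≤ edist a y}, edist a y ∂(Q : Measure S))
      atTop (𝓝 0) := by
  have hM := (lintegral_edist_lt_top hQ a).ne
  refine tendsto_setLIntegral_zero hM ?_
  have h0 : Tendsto (fun n : ℕ => (∫⁻ y, edist a y ∂(Q : Measure S)) / n) atTop (𝓝 0) := by
    simpa using ENNReal.Tendsto.const_div ENNReal.tendsto_nat_nhds_top (Or.inr hM)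
  refine tendsto_of_tendsto_of_tendsto_of_le_of_le' tendsto_const_nhds h0
    (Eventually.of_forall fun _ => zero_le) ?_
  filter_upwards [eventually_gt_atTop 0] with n hn
  exact meas_ge_le_lintegral_div (by fun_prop) (by positivity) (ENNReal.natCast_ne_top n)

/-- The measures at Wasserstein distance less than `C` from a fixed `Q ∈ 𝒫¹(S)` have, uniformly,
first moment at most `C + ε` outside a large ball. -/
theorem eventually_tail_le_of_wassersteinW_lt [SecondCountableTopology S] [BorelSpace S]
    {Q : ProbabilityMeasure S} (hQ : Q ∈ finiteFirstMoment S) (a : S)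
    {C ε : ℝ≥0∞} (hC : C ≠ ∞) (hε : ε ≠ 0) :
    ∀ᶠ n : ℕ in atTop, ∀ P : ProbabilityMeasure S, wassersteinW P Q < C →
      ∫⁻ x in (Metric.closedBall a n)ᶜ, edist a x ∂(P : Measure S) ≤ C + ε := by
  set M := ∫⁻ y, edist a y ∂(Q : Measure S) with hMdef
  have hM : M ≠ ∞ := (lintegral_edist_lt_top hQ a).ne
  have hε2 : ε / 2 ≠ 0 := (ENNReal.half_pos hε).ne'
  obtain ⟨r, hr⟩ := ((tendsto_setLIntegral_edist_nat hQ a).eventually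
    (gt_mem_nhds (pos_iff_ne_zero.2 hε2))).exists
  -- C + M will bound the first moment of P, so r(C + M)/n bounds r P(B) by Markov.
  have hlim : Tendsto (fun n : ℕ => ((r : ℝ≥0∞) * (C + M)) / n) atTop (𝓝 0) := by
    simpa using ENNReal.Tendsto.const_div ENNReal.tendsto_nat_nhds_top
      (Or.inr (ENNReal.mul_ne_top (ENNReal.natCast_ne_top r) (ENNReal.add_ne_top.2 ⟨hC, hM⟩)))
  filter_upwards [hlim.eventually (gt_mem_nhds (pos_iff_ne_zero.2 hε2)), eventually_gt_atTop 0]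
    with n hn hn0 P hP
  obtain ⟨π, hπ, hcost⟩ := by simpa only [wassersteinW, iInf_lt_iff, exists_prop] using hP
  set μ : Measure (S × S) := (π : Measure (S × S))
  set B : Set S := (Metric.closedBall a n)ᶜ
  set T : Set S := {y | (r : ℝ≥0∞) ≤ edist a y}
  have hB : MeasurableSet B := Metric.isClosed_closedBall.measurableSet.compl
  have hT : MeasurableSet T := measurableSet_le measurable_const (by fun_prop)
  have hmom : ∫⁻ x, edist a x ∂(P : Measure S) ≤ C + M := by
    rw [hMdef, ← hπ.1, ← hπ.2, lintegral_map (by fun_prop) measurable_fst,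
      lintegral_map (by fun_prop) measurable_snd]
    refine le_trans (lintegral_mono fun z => ?_)
      ((lintegral_add_left (f := fun z : S × S => edist z.1 z.2) (by fun_prop)
        fun z => edist a z.2).le.trans (by gcongr))
    rw [add_comm, edist_comm z.1]
    exact edist_triangle _ _ _
  have hPB : (P : Measure S) B ≤ (C + M) / n := by
    refine le_trans (measure_mono fun x hx => ?_)
      ((meas_ge_le_lintegral_div (f := fun x => edist a x) (ε := n) (by fun_prop) (by positivity)
        (ENNReal.natCast_ne_top n)).trans (by gcongr))
    have hx : (n : ℝ) < dist a x := by simpa [B, dist_comm] using hx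
    simp only [Set.mem_ofPred_eq, edist_dist]
    rw [← ENNReal.ofReal_natCast]
    exact ENNReal.ofReal_le_ofReal hx.le
  -- When z.1 ∈ B, the term d(a, z.2) is either in the tail of Q or below r, and r is charged to the
  -- event z.1 ∈ B.
  have key : ∀ z : S × S, B.indicator (fun x => edist a x) z.1 ≤
      edist z.1 z.2 + (T.indicator (fun y => edist a y) z.2
        + B.indicator (fun _ => (r : ℝ≥0∞)) z.1) := by
    intro z
    by_cases hz : z.1 ∈ B
    · simp only [hz, Set.indicator_of_mem]
      have htri : edist a z.1 ≤ edist z.1 z.2 + edist a z.2 := by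
        rw [add_comm, edist_comm z.1]; exact edist_triangle _ _ _
      refine htri.trans ?_
      gcongr
      by_cases hz2 : z.2 ∈ T
      · simp [hz2]
      · exact le_add_left (not_le.1 hz2).le
    · simp [hz]
  calc ∫⁻ x in B, edist a x ∂(P : Measure S)
      = ∫⁻ z, B.indicator (fun x => edist a x) z.1 ∂μ := by
        rw [← lintegral_indicator hB, ← hπ.1, lintegral_map (by fun_prop (disch := exact hB))
          measurable_fst]
    _ ≤ ∫⁻ z, (edist z.1 z.2 + (T.indicator (fun y => edist a y) z.2
          + B.indicator (fun _ => (r : ℝ≥0∞)) z.1)) ∂μ := lintegral_mono key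
    _ = ∫⁻ z, edist z.1 z.2 ∂μ + (∫⁻ y in T, edist a y ∂(Q : Measure S)
          + r * (P : Measure S) B) := by
        have h1 : Measurable (T.indicator fun y => edist a y) :=
          Measurable.indicator (by fun_prop) hT
        have h2 : Measurable (B.indicator fun _ : S => (r : ℝ≥0∞)) := measurable_const.indicator hB
        rw [lintegral_add_left (by fun_prop),
          lintegral_add_left (f := fun z : S × S => T.indicator (fun y => edist a y) z.2)
            (h1.comp measurable_snd),
          ← lintegral_indicator hT, ← hπ.2, lintegral_map h1 measurable_snd,
          ← lintegral_indicator_const hB, ← hπ.1, lintegral_map h2 measurable_fst]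
    _ ≤ C + (ε / 2 + ε / 2) := by
        refine add_le_add hcost.le (add_le_add hr.le (le_trans ?_ hn.le))
        rw [mul_div_assoc]
        gcongr
    _ = C + ε := by rw [ENNReal.add_halves]

theorem muUI_le_muHW [SecondCountableTopology S] [BorelSpace S] [Nonempty S]
    (Γ : Set (ProbabilityMeasure S)) : muUI Γ ≤ muHW Γ := by
  obtain ⟨a⟩ := ‹Nonempty S›
  refine le_iInf fun Φ => le_iInf fun hΦ => le_iInf fun hfin => ?_
  set c := ⨆ P ∈ Γ, ⨅ Q ∈ Φ, wassersteinW P Q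
  refine ENNReal.le_of_forall_pos_le_add fun ε hε hctop => ?_
  have hε' : (ε : ℝ≥0∞) / 2 ≠ 0 := (ENNReal.half_pos (by positivity)).ne'
  have hC : c + ε / 2 ≠ ∞ :=
    ENNReal.add_ne_top.2 ⟨hctop.ne, ENNReal.div_ne_top ENNReal.coe_ne_top two_ne_zero⟩
  obtain ⟨n, hn⟩ := ((eventually_all_finite hfin).2 fun Q hQ =>
    eventually_tail_le_of_wassersteinW_lt (hΦ hQ) a hC hε').exists
  unfold muUI
  refine iInf_le_of_le a <| iInf_le_of_le (Metric.closedBall a n) <|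
    iInf_le_of_le Metric.isBounded_closedBall <|
    iInf_le_of_le Metric.isClosed_closedBall.measurableSet ?_
  refine iSup₂_le fun P hP => ?_
  have hlt : ⨅ Q ∈ Φ, wassersteinW P Q < c + ε / 2 :=
    (le_iSup₂ (f := fun P (_ : P ∈ Γ) => ⨅ Q ∈ Φ, wassersteinW P Q) P hP).trans_lt
      (ENNReal.lt_add_right hctop.ne hε')
  obtain ⟨Q, hQ, hW⟩ := by simpa only [iInf_lt_iff, exists_prop] using hlt
  calc _ ≤ c + ε / 2 + ε / 2 := hn Q hQ P hW
    _ = c + ε := by rw [add_assoc, ENNReal.add_halves]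

/-! ### Finite nets of discrete measures -/

theorem ENNReal.exists_fin_div_le_and_le_add {p : ℝ≥0∞} (hp : p ≤ 1) {N : ℕ} (hN : N ≠ 0) :
    ∃ k : Fin (N + 1), (k : ℝ≥0∞) / N ≤ p ∧ p ≤ (k : ℝ≥0∞) / N + 1 / N := by
  have hp' : p ≠ ∞ := ne_top_of_le_ne_top ENNReal.one_ne_top hp
  lift p to NNReal using hp'
  have hp1 : p ≤ 1 := by exact_mod_cast hp
  have hk : ⌊p * N⌋₊ < N + 1 := by
    refine Nat.lt_succ_of_le (Nat.floor_le_of_le ?_)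
    exact mul_le_of_le_one_left (by positivity) hp1
  have hN0 : (0 : NNReal) < N := by positivity
  refine ⟨⟨⌊p * N⌋₊, hk⟩, ?_, ?_⟩
  · have : (⌊p * N⌋₊ : NNReal) / N ≤ p := (div_le_iff₀ hN0).2 (Nat.floor_le (by positivity))
    simpa [ENNReal.coe_div hN0.ne'] using ENNReal.coe_le_coe.2 this
  · have : p ≤ (⌊p * N⌋₊ : NNReal) / N + 1 / N := by
      rw [← add_div, le_div_iff₀ hN0]
      exact (Nat.lt_floor_add_one _).le
    simpa [ENNReal.coe_div hN0.ne', ENNReal.coe_inv hN0.ne'] using ENNReal.coe_le_coe.2 this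

/-- The measure with mass `k y / N` at each `y ∈ F`, and the mass missing from `1` at `a`. -/
noncomputable def gridMeasure (a : S) (F : Finset S) (N : ℕ) (k : F → Fin (N + 1)) : Measure S :=
  ∑ y : F, ((k y : ℝ≥0∞) / N) • Measure.dirac (y : S)
    + (1 - ∑ y : F, (k y : ℝ≥0∞) / N) • Measure.dirac a

theorem lintegral_gridMeasure_lt_top [OpensMeasurableSpace S] (a : S) (F : Finset S) {N : ℕ}
    (hN : N ≠ 0) (k : F → Fin (N + 1)) : ∫⁻ x, edist a x ∂(gridMeasure a F N k) < ∞ := by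
  simp only [gridMeasure, lintegral_add_measure, lintegral_finsetSum_measure,
    lintegral_smul_measure, lintegral_dirac, edist_self, smul_eq_mul, mul_zero, add_zero]
  exact ENNReal.sum_lt_top.2 fun y _ => ENNReal.mul_lt_top
    (ENNReal.div_lt_top (ENNReal.natCast_ne_top _) (by simpa using hN)) (edist_lt_top _ _)

/-- Pushing the part `h • P` of `P` forward by `f` and sending the rest of the mass to `a` gives a
coupling of `P`, whose cost exceeds `∫ d(x, f x) dP` by at most `∫ (1 - h) d(f x, a) dP`. -/
theorem exists_coupling_le [SecondCountableTopology S] [BorelSpace S] (P Q : ProbabilityMeasure S)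
    {f : S → S} (hf : Measurable f) {h : S → ℝ≥0∞} (hh : Measurable h) (h1 : ∀ x, h x ≤ 1) (a : S)
    (hQ : ((P : Measure S).withDensity h).map f
      + ((P : Measure S).withDensity (1 - h)).map (fun _ => a) = Q) :
    wassersteinW P Q ≤ ∫⁻ x, edist x (f x) ∂(P : Measure S)
      + ∫⁻ x, (1 - h x) * edist (f x) a ∂(P : Measure S) := by
  set ν₁ := (P : Measure S).withDensity h
  set ν₂ := (P : Measure S).withDensity (1 - h)
  have hh' : Measurable (1 - h) := measurable_const.sub hh
  have hg₁ : Measurable fun x => (x, f x) := by fun_prop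
  have hg₂ : Measurable fun x : S => (x, a) := by fun_prop
  set π : Measure (S × S) := ν₁.map (fun x => (x, f x)) + ν₂.map (fun x => (x, a))
  have hfst : π.map Prod.fst = P := by
    rw [Measure.map_add _ _ measurable_fst, Measure.map_map measurable_fst hg₁,
      Measure.map_map measurable_fst hg₂]
    change ν₁.map id + ν₂.map id = P
    rw [Measure.map_id, Measure.map_id, ← withDensity_add_left hh]
    have : h + (1 - h) = 1 := funext fun x => add_tsub_cancel_of_le (h1 x)
    rw [this, withDensity_one]
  have hsnd : π.map Prod.snd = Q := by
    rw [Measure.map_add _ _ measurable_snd, Measure.map_map measurable_snd hg₁,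
      Measure.map_map measurable_snd hg₂]
    exact hQ
  have hπ : IsProbabilityMeasure π := by
    refine ⟨?_⟩
    rw [← Set.preimage_univ (f := Prod.fst), ← Measure.map_apply measurable_fst .univ, hfst]
    exact measure_univ
  refine iInf₂_le_of_le (⟨π, hπ⟩ : ProbabilityMeasure (S × S)) ⟨hfst, hsnd⟩ ?_
  have hd₁ : Measurable fun x => edist x (f x) := by fun_prop
  have hd₂ : Measurable fun x : S => edist x a := by fun_prop
  change ∫⁻ z, edist z.1 z.2 ∂π ≤ _
  rw [lintegral_add_measure, lintegral_map (by fun_prop) hg₁, lintegral_map (by fun_prop) hg₂,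
    lintegral_withDensity_eq_lintegral_mul _ hh hd₁,
    lintegral_withDensity_eq_lintegral_mul _ hh' hd₂,
    ← lintegral_add_left (hh.mul hd₁), ← lintegral_add_left hd₁]
  refine lintegral_mono fun x => ?_
  calc h x * edist x (f x) + (1 - h x) * edist x a
      ≤ h x * edist x (f x) + (1 - h x) * (edist x (f x) + edist (f x) a) := by
        gcongr
        exact edist_triangle _ _ _
    _ = (h x + (1 - h x)) * edist x (f x) + (1 - h x) * edist (f x) a := by ring
    _ = edist x (f x) + (1 - h x) * edist (f x) a := by
        rw [add_tsub_cancel_of_le (h1 x), one_mul]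

theorem SimpleFunc.lintegral_comp {α β : Type*} [MeasurableSpace α] (μ : Measure α)
    (f : SimpleFunc α β) (g : β → ℝ≥0∞) :
    ∫⁻ x, g (f x) ∂μ = ∑ y ∈ f.range, g y * μ (f ⁻¹' {y}) := by
  rw [← SimpleFunc.map_lintegral, ← SimpleFunc.lintegral_eq_lintegral]
  rfl

/-- Here w y is the fraction of the fibre over y that is kept, so y receives exactly k y / N and all
the remaining mass goes to a. -/
theorem SimpleFunc.map_withDensity_add_eq_gridMeasure {α : Type*} [MeasurableSpace α]
    [MeasurableSingletonClass α] (P : Measure α) [IsProbabilityMeasure P]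
    (f : SimpleFunc α α) (a : α) {N : ℕ}
    (k : α → Fin (N + 1)) {w : α → ℝ≥0∞} (hw1 : ∀ y, w y ≤ 1)
    (hw : ∀ y, w y * P (f ⁻¹' {y}) = (k y : ℝ≥0∞) / N) :
    (P.withDensity fun x => w (f x)).map f
      + (P.withDensity (1 - fun x => w (f x))).map (fun _ => a)
      = gridMeasure a f.range N (fun y => k y) := by
  have hh : Measurable fun x => w (f x) := (f.map w).measurable
  have hsum : ∫⁻ x, w (f x) ∂P = ∑ y : f.range, (k y : ℝ≥0∞) / N := by
    rw [SimpleFunc.lintegral_comp, Finset.sum_coe_sort f.range fun y => (k y : ℝ≥0∞) / N]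
    exact Finset.sum_congr rfl fun y _ => hw y
  have hle : ∫⁻ x, w (f x) ∂P ≤ 1 := (lintegral_mono fun x => hw1 (f x)).trans (by simp)
  have hmass : (P.withDensity (1 - fun x => w (f x))) Set.univ
      = 1 - ∑ y : f.range, (k y : ℝ≥0∞) / N := by
    rw [withDensity_apply _ .univ, setLIntegral_univ, ← hsum]
    simp only [Pi.sub_apply, Pi.one_apply]
    rw [lintegral_sub hh (ne_top_of_le_ne_top ENNReal.one_ne_top hle)
      (Filter.Eventually.of_forall fun x => hw1 (f x))]
    simp
  rw [gridMeasure, Measure.map_const, hmass]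
  congr 1
  ext s hs
  rw [Measure.map_apply f.measurable hs, withDensity_apply _ (f.measurable hs),
    ← lintegral_indicator (f.measurable hs)]
  change ∫⁻ x, s.indicator w (f x) ∂P = _
  rw [SimpleFunc.lintegral_comp, Measure.finsetSum_apply,
    Finset.sum_coe_sort f.range fun y => (((k y : ℝ≥0∞) / N) • Measure.dirac y) s]
  refine Finset.sum_congr rfl fun y _ => ?_
  rw [Measure.smul_apply, Measure.dirac_apply' _ hs, smul_eq_mul, ← hw y]
  by_cases hy : y ∈ s <;> simp [hy]

/-- For a simple function `f`, some finite subset of `𝒫¹(S)` contains, for every probability measure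
`P`, a measure within `∫ d(x, f x) dP + ε` of `P`. -/
theorem exists_finite_wassersteinW_le_of_simpleFunc [SecondCountableTopology S] [BorelSpace S]
    (f : SimpleFunc S S) (a : S) {ε : ℝ≥0∞} (hε : ε ≠ 0) :
    ∃ Φ ⊆ finiteFirstMoment S, Φ.Finite ∧ ∀ P : ProbabilityMeasure S, ∃ Q ∈ Φ,
      wassersteinW P Q ≤ ∫⁻ x, edist x (f x) ∂(P : Measure S) + ε := by
  have hD : ∑ y ∈ f.range, edist y a ≠ ∞ := ENNReal.sum_ne_top.2 fun y _ => edist_ne_top y a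
  -- Rounding moves mass at most 1/N from each y to a, at total cost at most (∑ d(y,a))/N ≤ ε.
  obtain ⟨N, hDN⟩ := ENNReal.exists_nat_mul_gt hε hD
  have hN : N ≠ 0 := by
    rintro rfl
    simp at hDN
  -- Grid measures whose weights sum to more than 1 are not probability measures and drop out here.
  refine ⟨{Q | (Q : Measure S) ∈ Set.range (gridMeasure a f.range N)}, ?_, ?_, fun P => ?_⟩
  · rintro Q ⟨k, hk⟩
    exact ⟨a, hk ▸ lintegral_gridMeasure_lt_top a f.range hN k⟩
  · exact (Set.finite_range _).preimage Subtype.val_injective.injOn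
  set p : S → ℝ≥0∞ := fun y => (P : Measure S) (f ⁻¹' {y})
  choose k hk₁ hk₂ using fun y => ENNReal.exists_fin_div_le_and_le_add
    (p := p y) prob_le_one hN
  set w : S → ℝ≥0∞ := fun y => (k y : ℝ≥0∞) / N / p y
  have hw : ∀ y, w y * p y = (k y : ℝ≥0∞) / N := fun y =>
    -- A null fibre forces k y / N = 0, so the identity survives division by zero.
    ENNReal.div_mul_cancel' (fun h0 => le_antisymm (h0 ▸ hk₁ y) zero_le)
      (fun ht => absurd ht (measure_ne_top _ _))
  have hw1 : ∀ y, w y ≤ 1 := fun y => ENNReal.div_le_of_le_mul (by simpa using hk₁ y)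
  have hgrid := SimpleFunc.map_withDensity_add_eq_gridMeasure (P : Measure S) f a k hw1 hw
  have hh : Measurable fun x => w (f x) := (f.map w).measurable
  have hprob : IsProbabilityMeasure (gridMeasure a f.range N fun y => k y) := by
    refine ⟨?_⟩
    rw [← hgrid, Measure.add_apply, Measure.map_apply f.measurable .univ,
      Measure.map_apply measurable_const .univ, Set.preimage_univ, Set.preimage_univ,
      ← Measure.add_apply, ← withDensity_add_left hh]
    have : (fun x => w (f x)) + (1 - fun x => w (f x)) = 1 :=
      funext fun x => add_tsub_cancel_of_le (hw1 (f x))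
    rw [this, withDensity_one]
    exact measure_univ
  refine ⟨⟨_, hprob⟩, ⟨_, rfl⟩, ?_⟩
  refine (exists_coupling_le P ⟨_, hprob⟩ f.measurable hh (fun x => hw1 (f x)) a hgrid).trans ?_
  gcongr
  rw [SimpleFunc.lintegral_comp (P : Measure S) f fun y => (1 - w y) * edist y a]
  calc ∑ y ∈ f.range, (1 - w y) * edist y a * p y
      ≤ ∑ y ∈ f.range, edist y a / N := by
        refine Finset.sum_le_sum fun y _ => ?_
        have : (1 - w y) * p y ≤ 1 / N := by
          rw [ENNReal.sub_mul fun _ _ => measure_ne_top _ _, one_mul, hw]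
          exact tsub_le_iff_left.2 (hk₂ y)
        calc (1 - w y) * edist y a * p y = edist y a * ((1 - w y) * p y) := by ring
          _ ≤ edist y a * (1 / N) := by gcongr
          _ = edist y a / N := by rw [mul_one_div]
    _ = (∑ y ∈ f.range, edist y a) / N := by simp only [div_eq_mul_inv, Finset.sum_mul]
    _ ≤ ε := ENNReal.div_le_of_le_mul' hDN.le

/-! ### Tight sets and the reverse inequality -/

/-- On a tight set of measures, a single simple function moves the points of a bounded set by at
most `ε` on average and sends the rest of the space to `a`. -/
theorem exists_simpleFunc_lintegral_edist_le [TopologicalSpace.SeparableSpace S] [BorelSpace S]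
    {Γ : Set (Measure S)} (hΓ : IsTightMeasureSet Γ) (hprob : ∀ μ ∈ Γ, IsProbabilityMeasure μ)
    (a : S) {B : Set S} (hB : Bornology.IsBounded B) (hBm : MeasurableSet B)
    {ε : ℝ≥0∞} (hε : ε ≠ 0) :
    ∃ f : SimpleFunc S S, ∀ μ ∈ Γ,
      ∫⁻ x, edist x (f x) ∂μ ≤ ∫⁻ x in Bᶜ, edist a x ∂μ + ε := by
  have hε2 : ε / 2 ≠ 0 := (ENNReal.half_pos hε).ne'
  obtain ⟨R, hR⟩ := hB.subset_closedBall a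
  have hBR : ∀ x ∈ B, edist x a ≤ ENNReal.ofReal R := fun x hx => by
    rw [edist_dist]
    exact ENNReal.ofReal_le_ofReal (hR hx)
  -- Points of B off K travel at most R to a, so mass δ there costs less than ε/2.
  obtain ⟨δ, hδ, hδR⟩ := ENNReal.exists_nnreal_pos_mul_lt (a := ENNReal.ofReal R)
    ENNReal.ofReal_ne_top hε2
  obtain ⟨K, hK, hKΓ⟩ := isTightMeasureSet_iff_exists_isCompact_measure_compl_le.1 hΓ δ
    (by exact_mod_cast hδ)
  have hKm : MeasurableSet K := hK.isClosed.measurableSet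
  have : Nonempty S := ⟨a⟩
  set e : ℕ → S := TopologicalSpace.denseSeq S
  obtain ⟨t, ht⟩ := hK.elim_finite_subcover (fun n => {x | edist (e n) x < ε / 2})
    (fun n => isOpen_lt (by fun_prop) continuous_const) fun x _ => by
      obtain ⟨_, ⟨n, rfl⟩, hy⟩ := EMetric.mem_closure_iff.1
        (TopologicalSpace.denseRange_denseSeq S x) (ε / 2) (pos_iff_ne_zero.2 hε2)
      exact Set.mem_iUnion.2 ⟨n, by simpa [edist_comm] using hy⟩
  -- The bound `t.sup id` puts every centre of the finite subcover among the candidates.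
  set g : SimpleFunc S S := SimpleFunc.nearestPt e (t.sup id)
  have hg : ∀ x ∈ K, edist x (g x) ≤ ε / 2 := fun x hx => by
    obtain ⟨n, hn, hnx⟩ := Set.mem_iUnion₂.1 (ht hx)
    rw [edist_comm]
    exact (SimpleFunc.edist_nearestPt_le e x (Finset.le_sup (f := id) hn)).trans hnx.le
  refine ⟨SimpleFunc.piecewise (B ∩ K) (hBm.inter hKm) g (SimpleFunc.const S a), fun μ hμ => ?_⟩
  have := hprob μ hμ
  have hBi : Measurable (Bᶜ.indicator fun x => edist a x) :=
    Measurable.indicator (by fun_prop) hBm.compl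
  have key : ∀ x, edist x (SimpleFunc.piecewise (B ∩ K) (hBm.inter hKm) g (SimpleFunc.const S a) x)
      ≤ Bᶜ.indicator (fun x => edist a x) x
        + (ε / 2 + Kᶜ.indicator (fun _ => ENNReal.ofReal R) x) := by
    intro x
    by_cases hxB : x ∈ B <;> by_cases hxK : x ∈ K
    · simpa [hxB, hxK] using hg x hxK
    · simpa [hxB, hxK] using le_add_left (hBR x hxB)
    · simp [hxB, hxK, edist_comm]
    · simp [hxB, hxK, edist_comm]
  calc _ ≤ ∫⁻ x, (Bᶜ.indicator (fun x => edist a x) x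
        + (ε / 2 + Kᶜ.indicator (fun _ => ENNReal.ofReal R) x)) ∂μ := lintegral_mono key
    _ = ∫⁻ x in Bᶜ, edist a x ∂μ + (ε / 2 + ENNReal.ofReal R * μ Kᶜ) := by
        rw [lintegral_add_left hBi, lintegral_add_left measurable_const,
          lintegral_indicator hBm.compl, lintegral_indicator_const hKm.compl]
        simp
    _ ≤ ∫⁻ x in Bᶜ, edist a x ∂μ + (ε / 2 + ε / 2) := by
        gcongr
        refine le_trans ?_ hδR.le
        rw [mul_comm]
        gcongr
        exact hKΓ μ hμ
    _ = _ := by rw [ENNReal.add_halves]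

/-- The simple function depends on Γ but not on P, so its finite net serves all of Γ. -/
theorem muHW_le_muUI_of_isTightMeasureSet [TopologicalSpace.SeparableSpace S] [BorelSpace S]
    {Γ : Set (ProbabilityMeasure S)}
    (hΓ : IsTightMeasureSet {μ : Measure S | ∃ P ∈ Γ, (P : Measure S) = μ}) :
    muHW Γ ≤ muUI Γ := by
  have : SecondCountableTopology S := UniformSpace.secondCountable_of_separable S
  refine le_iInf fun a => le_iInf fun B => le_iInf fun hB => le_iInf fun hBm => ?_
  refine ENNReal.le_of_forall_pos_le_add fun ε hε _ => ?_
  have hε2 : (ε : ℝ≥0∞) / 2 ≠ 0 := (ENNReal.half_pos (by positivity)).ne'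
  obtain ⟨f, hf⟩ := exists_simpleFunc_lintegral_edist_le hΓ
    (by rintro _ ⟨P, -, rfl⟩; infer_instance) a hB hBm hε2
  obtain ⟨Φ, hΦ, hfin, hΦW⟩ := exists_finite_wassersteinW_le_of_simpleFunc f a hε2
  unfold muHW
  refine iInf_le_of_le Φ <| iInf_le_of_le hΦ <| iInf_le_of_le hfin <| iSup₂_le fun P hP => ?_
  obtain ⟨Q, hQ, hPQ⟩ := hΦW P
  refine iInf₂_le_of_le Q hQ ?_
  calc wassersteinW P Q
      ≤ ∫⁻ x in Bᶜ, edist a x ∂(P : Measure S) + ε / 2 + ε / 2 :=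
        hPQ.trans (by gcongr; exact hf _ ⟨P, hP, rfl⟩)
    _ = ∫⁻ x in Bᶜ, edist a x ∂(P : Measure S) + ε := by rw [add_assoc, ENNReal.add_halves]
    _ ≤ _ := by
        gcongr
        exact le_iSup₂ (f := fun (P : ProbabilityMeasure S) (_ : P ∈ Γ) =>
          ∫⁻ x in Bᶜ, edist a x ∂(P : Measure S)) P hP

end WassersteinNoncompactness

theorem theorem4p4 {S : Type*} [MetricSpace S] [CompleteSpace S]
    [TopologicalSpace.SeparableSpace S] [MeasurableSpace S] [BorelSpace S] [Nonempty S]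
    (Γ : Set (ProbabilityMeasure S)) (hΓ : Γ ⊆ finiteFirstMoment S) :
    muUI Γ ≤ muHW Γ ∧
      (IsTightMeasureSet {μ : Measure S | ∃ P ∈ Γ, (P : Measure S) = μ} →
        muUI Γ = muHW Γ) := by
  have : SecondCountableTopology S := UniformSpace.secondCountable_of_separable S
  exact ⟨muUI_le_muHW Γ, fun hT =>
    le_antisymm (muUI_le_muHW Γ) (muHW_le_muUI_of_isTightMeasureSet hT)⟩
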